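/- An ultrafilter $p$ on $\omega$ is called selective if it is nonprincipal and for every partition $(A_k)_{k\in\omega}$ of $\omega$ (some pieces may be empty) either $A_k\in p$ for some $k$, or there is $B\in p$ such that $|B\cap A_k|\le 1$ for all $k$. A topological space $X$ is $p$-compact if every sequence $(x_n)_{n\in\omega}$ in $X$ has a $p$-limit, i.e. a point $l\in X$ such that $\{n\in\omega : x_n\in U\}\in p$ for every neighbourhood $U$ of $l$. $X$ has no non-trivial convergent sequences if every convergent sequence in $X$ is eventually constant. Theorem. Let $p$ be a selective ultrafilter on $\omega$. (1) Let $\kappa$ be an infinite cardinal with $\kappa^{\omega}=\kappa$, and let $\mathbb{Q}^{(\kappa)}$ be the direct sum of $\kappa$ copies of the additive group $\mathbb{Q}$. Then there is a Hausdorff group topology on $\mathbb{Q}^{(\kappa)}$ that is $p$-compact, has no non-trivial convergent sequences, and is the initial topology induced by some family of group homomorphisms $\mathbb{Q}^{(\kappa)}\to\mathbb{T}=\mathbb{R}/\mathbb{Z}$. (2) Consequently, for every cardinal $\mu$ there is a torsion-free Hausdorff topological abelian group of cardinality at least $\mu$ that is countably compact and has no non-trivial convergent sequences. -/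

import Mathlib

open Filter Topology Cardinal

universe u

/-- A selective ultrafilter on `ω`: a nonprincipal ultrafilter such that for every partition of `ω`
(given as the fibres of a function `f`) either some piece lies in `p`, or some member of `p` meets
every piece in at most one point. -/
def IsSelective (p : Ultrafilter ℕ) : Prop :=
  (∀ n : ℕ, ({n} : Set ℕ) ∉ p) ∧
    ∀ f : ℕ → ℕ, (∃ k : ℕ, f ⁻¹' {k} ∈ p) ∨ ∃ B ∈ p, Set.InjOn f B

/-- A space is `p`-compact if every sequence in it has a `p`-limit, that is, a point `l` such that
`{n | x n ∈ U} ∈ p` for every neighbourhood `U` of `l`. -/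
def IsUltraCompact (p : Ultrafilter ℕ) (X : Type u) [TopologicalSpace X] : Prop :=
  ∀ x : ℕ → X, ∃ l : X, Tendsto x (p : Filter ℕ) (𝓝 l)

/-- A space has no non-trivial convergent sequences: every convergent sequence is eventually
constant. -/
def NoNontrivialConvergentSeq (X : Type u) [TopologicalSpace X] : Prop :=
  ∀ (x : ℕ → X) (l : X), Tendsto x atTop (𝓝 l) → EventuallyConst x atTop

/-! Let V = ℚ^(κ). Choose sequences `f b` forming a basis of V^ω modulo the `p`-constant sequences,
and give each a coordinate `j b` of rank above all supports of its terms. Topologize V by the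
characters φ with p-lim φ(q f_b(n)) = φ(q e_{j b}) for all rational q; characters are only additive,
so every multiple must be listed. Any sequence is `p`-almost everywhere c + ∑ a_b f_b, so c + ∑ a_b
e_{j b} is a `p`-limit of it.

It remains to find enough such characters. By recursion on rank, a character with the right limits
on a countable closed set of coordinates can be changed outside it to have all of them. So only a
countable space U of sequences f_b - e_{j b} must be sent to 0 along `p`, and U has no nonzero
`p`-constant limits.

Such a character, with φ(d) ≠ 0, is a limit of successive approximations by a quantitative Kronecker
theorem: each step sees only relations with bounded coefficients, and these are harmless for
`p`-many n. Selectivity diagonalizes over the steps. This separates points. Against x converging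
nontrivially to l, adjoin a suitable x∘σ - l - d to U: then φ(x(σ n)) tends to φ(l) + φ(d) ≠ φ(l)
along `p`. -/

/-! ### Selective ultrafilters. -/

/-- Diagonal intersections of members of a selective ultrafilter. -/
theorem IsSelective.exists_forall_lt_mem {p : Ultrafilter ℕ} (hp : IsSelective p)
    (A : ℕ → Set ℕ) (hA : ∀ m, A m ∈ p) :
    ∃ C ∈ p, ∀ m ∈ C, ∀ n ∈ C, m < n → n ∈ A m := by
  obtain ⟨hnp, hsel⟩ := hp
  have hfin : ∀ s : Set ℕ, s.Finite → s ∉ p := by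
    intro s hs h
    obtain ⟨n, -, hn⟩ := (Ultrafilter.finite_biUnion_mem_iff hs).1
      (show (⋃ n ∈ s, {n}) ∈ p by simpa using h)
    exact hnp n hn
  have hcofin : ∀ s : Set ℕ, s.Finite → sᶜ ∈ p := fun s hs =>
    Ultrafilter.compl_mem_iff_notMem.2 (hfin s hs)
  set A' : ℕ → Set ℕ := fun m => (⋂ j ∈ Set.Iic m, A j) ∩ (Set.Iic m)ᶜ with hA'
  have hA'p : ∀ m, A' m ∈ p := fun m =>
    inter_mem ((biInter_mem (Set.finite_Iic m)).2 fun j _ => hA j) (hcofin _ (Set.finite_Iic m))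
  have hA'anti : ∀ i j, i ≤ j → A' j ⊆ A' i := by
    rintro i j hij n ⟨hn1, hn2⟩
    simp only [Set.mem_iInter, Set.mem_Iic, Set.mem_compl_iff] at hn1 hn2
    refine ⟨?_, ?_⟩
    · simp only [Set.mem_iInter, Set.mem_Iic]
      exact fun k hk => hn1 k (hk.trans hij)
    · simp only [Set.mem_compl_iff, Set.mem_Iic]; omega
  have hex : ∀ n, ∃ m, n ∉ A' m := fun n => ⟨n, fun h => h.2 (le_refl n)⟩
  classical
  -- The fibres of `f` are the layers of the decreasing sequence `A'`; a selector meets each layer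
  -- at most once, so it is almost contained in every `A' m`.
  let f : ℕ → ℕ := fun n => Nat.find (hex n)
  have hf : ∀ n, n ∉ A' (f n) := fun n => Nat.find_spec (hex n)
  have hf2 : ∀ n m, n ∉ A' m → f n ≤ m := fun n m h => Nat.find_min' (hex n) h
  obtain ⟨B, hB, hinj⟩ : ∃ B ∈ p, Set.InjOn f B := by
    rcases hsel f with ⟨k, hk⟩ | h
    · exfalso
      have h1 := inter_mem hk (hA'p k)
      obtain ⟨n, hn1, hn2⟩ := Ultrafilter.nonempty_of_mem h1
      simp only [Set.mem_preimage, Set.mem_singleton_iff] at hn1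
      exact hf n (hn1 ▸ hn2)
    · exact h
  have hBfin : ∀ m, (B \ A' m).Finite := by
    intro m
    refine Set.Finite.of_finite_image (f := f) ((Set.finite_Iic m).subset ?_)
      (hinj.mono Set.sdiff_subset)
    rintro _ ⟨n, hn, rfl⟩
    exact hf2 n m hn.2
  have hg : ∀ m, ∃ g, m < g ∧ ∀ n ∈ B, g ≤ n → n ∈ A' m := by
    intro m
    obtain ⟨b, hb⟩ := (hBfin m).bddAbove
    refine ⟨max b m + 1, by omega, fun n hn hle => ?_⟩
    by_contra h
    have := hb ⟨hn, h⟩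
    omega
  choose g hgm hg using hg
  obtain ⟨a, ha0, hasucc⟩ : ∃ a : ℕ → ℕ, a 0 = 0 ∧ ∀ k, a (k + 1) = g (a k) :=
    ⟨fun k => Nat.rec 0 (fun _ x => g x) k, rfl, fun _ => rfl⟩
  have hamono : StrictMono a := strictMono_nat_of_lt_succ fun k => by rw [hasucc]; exact hgm _
  -- Index of the interval [a k, a (k+1)) containing n. One point per interval and constant parity
  -- of the index leave a whole interval between two chosen points, enough room for `g`.
  let c : ℕ → ℕ := fun n => Nat.findGreatest (fun k => a k ≤ n) n
  have hc1 : ∀ n, a (c n) ≤ n := by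
    intro n
    have h0 : a 0 ≤ n := by simp [ha0]
    exact Nat.findGreatest_spec (P := fun k => a k ≤ n) (Nat.zero_le n) h0
  have hc2 : ∀ n, n < a (c n + 1) := by
    intro n
    by_contra! h
    have : c n + 1 ≤ c n := Nat.le_findGreatest ((hamono.id_le _).trans h) h
    omega
  obtain ⟨B', hB', hinj'⟩ : ∃ B ∈ p, Set.InjOn c B := by
    rcases hsel c with ⟨k, hk⟩ | h
    · exact absurd hk (hfin _ ((Set.finite_Iio (a (k + 1))).subset fun n hn => by
        simp only [Set.mem_preimage, Set.mem_singleton_iff] at hn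
        exact hn ▸ hc2 n))
    · exact h
  obtain ⟨D, hD, hpar⟩ : ∃ D ∈ p, ∀ m ∈ D, ∀ n ∈ D, c m % 2 = c n % 2 := by
    rcases Ultrafilter.mem_or_compl_mem p {n | c n % 2 = 0} with h | h
    · exact ⟨_, h, fun m hm n hn => by simp at hm hn; omega⟩
    · exact ⟨_, h, fun m hm n hn => by simp at hm hn; omega⟩
  refine ⟨B ∩ B' ∩ D, inter_mem (inter_mem hB hB') hD, ?_⟩
  rintro m ⟨⟨hmB, hmB'⟩, hmD⟩ n ⟨⟨hnB, hnB'⟩, hnD⟩ hlt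
  have hcle : c m ≤ c n := by
    by_contra! h
    have := hamono.monotone (show c n + 1 ≤ c m by omega)
    have := hc1 m
    have := hc2 n
    omega
  have hcne : c m ≠ c n := fun h => hlt.ne (hinj' hmB' hnB' h)
  have hpar := hpar m hmD n hnD
  have h2 : a (c m + 2) ≤ n := (hamono.monotone (by omega)).trans (hc1 n)
  rw [hasucc] at h2
  have := hA'anti m (a (c m + 1)) (hc2 m).le (hg _ n hnB h2)
  have h3 := this.1
  simp only [Set.mem_iInter, Set.mem_Iic] at h3
  exact h3 m le_rfl

/-! ### Quantitative Kronecker approximation. -/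

/-- A nonzero vector of a rational vector space is sent to the point of order two by some
character. -/
theorem exists_addMonoidHom_unitAddCircle_apply_eq_half {V : Type*} [AddCommGroup V] [Module ℚ V]
    {v : V} (hv : v ≠ 0) :
    ∃ ψ : V →+ UnitAddCircle, ψ v = ((1 / 2 : ℝ) : UnitAddCircle) := by
  obtain ⟨f, hf⟩ := Module.Projective.exists_dual_ne_zero ℚ hv
  let g : ℚ →+ UnitAddCircle :=
    (QuotientAddGroup.mk' (AddSubgroup.zmultiples (1 : ℝ))).comp (algebraMap ℚ ℝ).toAddMonoidHom
  refine ⟨g.comp ((2 * f v)⁻¹ • f).toAddMonoidHom, ?_⟩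
  have : (2 * f v)⁻¹ * f v = 1 / 2 := by field_simp
  have h2 : (g.comp ((2 * f v)⁻¹ • f).toAddMonoidHom) v = g ((2 * f v)⁻¹ * f v) := rfl
  rw [h2, this]
  have h3 : g (1 / 2) = (((1 / 2 : ℚ) : ℝ) : UnitAddCircle) := rfl
  rw [h3]
  norm_num

theorem toCircle_half : ((AddCircle.toCircle ((1 / 2 : ℝ) : UnitAddCircle) : Circle) : ℂ) = -1 := by
  rw [AddCircle.toCircle_apply_mk]
  rw [Circle.coe_exp]
  rw [← Complex.exp_pi_mul_I]
  congr 1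
  push_cast
  ring

/-- The constant term of a trigonometric polynomial is a lower bound for its supremum. -/
theorem exists_re_sum_toCircle_ge {V : Type*} [AddCommGroup V] [Module ℚ V] {J : Type*}
    (s : Finset J) (u : J → V) [DecidablePred fun j => u j = 0] (c : J → ℂ) :
    ∃ φ : V →+ UnitAddCircle,
      (∑ j ∈ s with u j = 0, c j).re ≤ (∑ j ∈ s, c j * (AddCircle.toCircle (φ (u j)) : ℂ)).re := by
  classical
  suffices h : ∀ (t : Finset V) (c : J → ℂ), (∀ j ∈ s, u j ∈ t ∨ u j = 0 ∨ c j = 0) →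
      ∃ φ : V →+ UnitAddCircle, (∑ j ∈ s with u j = 0, c j).re ≤
        (∑ j ∈ s, c j * (AddCircle.toCircle (φ (u j)) : ℂ)).re from
    h (s.image u) c fun j hj => Or.inl (Finset.mem_image_of_mem u hj)
  intro t
  induction t using Finset.induction_on with
  | empty =>
    intro c hc
    refine ⟨0, le_of_eq ?_⟩
    rw [Finset.sum_filter]
    congr 1
    refine Finset.sum_congr rfl fun j hj => ?_
    rcases hc j hj with h | h | h
    · simp at h
    · simp [h]
    · simp [h]
  | insert v t hvt ih =>
    intro c hc
    by_cases hv : v = 0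
    · refine ih c fun j hj => ?_
      rcases hc j hj with h | h | h
      · rcases Finset.mem_insert.1 h with h | h
        · exact Or.inr (Or.inl (h.trans hv))
        · exact Or.inl h
      · exact Or.inr (Or.inl h)
      · exact Or.inr (Or.inr h)
    obtain ⟨ψ, hψ⟩ := exists_addMonoidHom_unitAddCircle_apply_eq_half hv
    -- Averaging over φ and φ + ψ multiplies the coefficient at u by (1 + e(ψ u))/2: this kills
    -- frequency v and keeps the constant term.
    obtain ⟨φ, hφ⟩ := ih (fun j => c j * ((1 + (AddCircle.toCircle (ψ (u j)) : ℂ)) / 2)) (by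
      intro j hj
      rcases hc j hj with h | h | h
      · rcases Finset.mem_insert.1 h with h | h
        · refine Or.inr (Or.inr ?_)
          simp only [h, hψ, toCircle_half]
          norm_num
        · exact Or.inl h
      · exact Or.inr (Or.inl h)
      · exact Or.inr (Or.inr (by simp [h])))
    have h1 : ∑ j ∈ s with u j = 0, c j * ((1 + (AddCircle.toCircle (ψ (u j)) : ℂ)) / 2) =
        ∑ j ∈ s with u j = 0, c j := by
      refine Finset.sum_congr rfl fun j hj => ?_
      rw [(Finset.mem_filter.1 hj).2]
      simp
    have h2 : ∑ j ∈ s, c j * ((1 + (AddCircle.toCircle (ψ (u j)) : ℂ)) / 2) *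
          (AddCircle.toCircle (φ (u j)) : ℂ) =
        (1 / 2 : ℝ) * (∑ j ∈ s, c j * (AddCircle.toCircle (φ (u j)) : ℂ) +
          ∑ j ∈ s, c j * (AddCircle.toCircle ((φ + ψ) (u j)) : ℂ)) := by
      rw [← Finset.sum_add_distrib, Finset.mul_sum]
      refine Finset.sum_congr rfl fun j _ => ?_
      rw [AddMonoidHom.add_apply, AddCircle.toCircle_add, Circle.coe_mul]
      push_cast
      ring
    rw [h1, h2, Complex.re_ofReal_mul, Complex.add_re] at hφ
    by_cases hle : (∑ j ∈ s with u j = 0, c j).re ≤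
        (∑ j ∈ s, c j * (AddCircle.toCircle (φ (u j)) : ℂ)).re
    · exact ⟨φ, hle⟩
    · exact ⟨φ + ψ, by linarith⟩

/-- Strict convexity of the disc away from t = 0, made uniform by compactness. -/
theorem exists_norm_one_add_toCircle_le {ε : ℝ} (hε : 0 < ε) :
    ∃ ρ : ℝ, 0 ≤ ρ ∧ ρ < 1 ∧
      ∀ t : UnitAddCircle, ε ≤ ‖t‖ → ‖(1 + (AddCircle.toCircle t : ℂ)) / 2‖ ≤ ρ := by
  have hcont : Continuous fun t : UnitAddCircle => ‖(1 + (AddCircle.toCircle t : ℂ)) / 2‖ := by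
    have : Continuous fun t : UnitAddCircle => (AddCircle.toCircle t : ℂ) :=
      continuous_induced_dom.comp AddCircle.continuous_toCircle
    fun_prop
  have hK : IsCompact {t : UnitAddCircle | ε ≤ ‖t‖} :=
    (isClosed_le continuous_const continuous_norm).isCompact
  rcases Set.eq_empty_or_nonempty {t : UnitAddCircle | ε ≤ ‖t‖} with h | h
  · refine ⟨0, le_rfl, one_pos, fun t ht => ?_⟩
    have : t ∈ ({t : UnitAddCircle | ε ≤ ‖t‖}) := ht
    rw [h] at this
    exact this.elim
  obtain ⟨t₀, ht₀, hmax⟩ := hK.exists_isMaxOn h hcont.continuousOn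
  refine ⟨_, norm_nonneg _, ?_, fun t ht => hmax ht⟩
  set z : ℂ := (AddCircle.toCircle t₀ : ℂ) with hz
  have hz1 : ‖z‖ = 1 := Circle.norm_coe _
  have hne : z ≠ 1 := by
    intro h
    have h1 : AddCircle.toCircle t₀ = 1 := Circle.coe_eq_one.1 h
    have h2 : t₀ = 0 := AddCircle.injective_toCircle one_ne_zero (by rw [h1, AddCircle.toCircle_zero])
    have h3 : ε ≤ ‖t₀‖ := ht₀
    rw [h2, norm_zero] at h3
    exact absurd h3 (not_le.2 hε)
  have hpar := parallelogram_law_with_norm ℝ (1 : ℂ) z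
  rw [hz1, norm_one] at hpar
  have hpos : 0 < ‖1 - z‖ := norm_pos_iff.2 (sub_ne_zero.2 (Ne.symm hne))
  rw [norm_div, RCLike.norm_ofNat, div_lt_one two_pos]
  nlinarith [norm_nonneg (1 + z)]

theorem exists_succ_pow_mul_pow_lt_one (m : ℕ) {ρ : ℝ} (h0 : 0 ≤ ρ) (h1 : ρ < 1) :
    ∃ L : ℕ, 0 < L ∧ ((L : ℝ) + 1) ^ m * ρ ^ L < 1 := by
  have h := tendsto_pow_const_mul_const_pow_of_lt_one m h0 h1
  have h3 : Tendsto (fun L : ℕ => ((L : ℝ) + 1) ^ m * ρ ^ L) atTop (𝓝 0) := by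
    rcases h0.eq_or_lt with h0 | h0
    · refine tendsto_const_nhds.congr' ?_
      filter_upwards [eventually_gt_atTop 0] with L hL
      rw [← h0, zero_pow hL.ne', mul_zero]
    · have h4 := (h.comp (tendsto_add_atTop_nat 1)).const_mul ρ⁻¹
      rw [mul_zero] at h4
      refine h4.congr fun L => ?_
      simp only [Function.comp_apply, pow_succ ρ L]
      push_cast
      field_simp
  obtain ⟨L, hL1, hL2⟩ := ((h3.eventually_lt_const one_pos).and (eventually_gt_atTop 0)).exists
  exact ⟨L, hL2, hL1⟩

/-- A product of powers of `(1 + z i) / 2`, expanded. -/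
theorem prod_one_add_div_two_pow {I : Type*} [Fintype I] [DecidableEq I] (L : ℕ) (z : I → ℂ) :
    ∏ i, ((1 + z i) / 2) ^ L =
      ∑ a ∈ Fintype.piFinset fun _ : I => Finset.range (L + 1),
        ((∏ i, (L.choose (a i) : ℝ) / 2 ^ L : ℝ) : ℂ) * ∏ i, z i ^ a i := by
  have h : ∀ i, ((1 + z i) / 2) ^ L =
      ∑ k ∈ Finset.range (L + 1), (((L.choose k : ℝ) / 2 ^ L : ℝ) : ℂ) * z i ^ k := by
    intro i
    rw [div_pow, add_comm, add_pow, Finset.sum_div]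
    refine Finset.sum_congr rfl fun k _ => ?_
    push_cast
    ring
  simp_rw [h]
  rw [Finset.prod_univ_sum]
  refine Finset.sum_congr rfl fun a _ => ?_
  rw [Finset.prod_mul_distrib]
  push_cast
  rfl

theorem toCircle_sum_nsmul {I : Type*} [Fintype I] (a : I → ℕ) (t : I → UnitAddCircle) :
    ∏ i, (AddCircle.toCircle (t i) : ℂ) ^ a i = (AddCircle.toCircle (∑ i, a i • t i) : ℂ) := by
  classical
  have key : ∀ s : Finset I, ∏ i ∈ s, (AddCircle.toCircle (t i) : ℂ) ^ a i =
      (AddCircle.toCircle (∑ i ∈ s, a i • t i) : ℂ) := by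
    intro s
    induction s using Finset.induction_on with
    | empty => simp
    | insert i s hi ih =>
      rw [Finset.prod_insert hi, Finset.sum_insert hi, AddCircle.toCircle_add, Circle.coe_mul, ih,
        AddCircle.toCircle_nsmul, Circle.coe_pow]
  exact key _

/-- A quantitative form of Kronecker's theorem: a system of congruences is approximately solvable
by a character as soon as it is compatible with all relations with small coefficients. -/
theorem exists_kronecker_bound {V : Type*} [AddCommGroup V] [Module ℚ V] (I : Type*) [Fintype I]
    {ε : ℝ} (hε : 0 < ε) :
    ∃ L : ℕ, ∀ (u : I → V) (θ : I → UnitAddCircle),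
      (∀ a : I → ℤ, (∀ i, |a i| ≤ L) → ∑ i, a i • u i = 0 → ∑ i, a i • θ i = 0) →
      ∃ φ : V →+ UnitAddCircle, ∀ i, ‖φ (u i) - θ i‖ < ε := by
  classical
  obtain ⟨ρ, hρ0, hρ1, hρ⟩ := exists_norm_one_add_toCircle_le hε
  obtain ⟨L, hL0, hL⟩ := exists_succ_pow_mul_pow_lt_one (Fintype.card I)
    (sq_nonneg ρ) (by nlinarith : ρ ^ 2 < 1)
  refine ⟨L, fun u θ hrel => ?_⟩
  set S := Fintype.piFinset fun _ : I => Finset.range (L + 1) with hS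
  -- The test polynomial is |∏ ((1 + z_i)/2)^L|². Its constant term is at least ∑ C², hence at least
  -- (L+1)^(-|I|) by Cauchy–Schwarz, while a single error of size ε forces the value below ρ^(2L).
  let C : (I → ℕ) → ℝ := fun a => ∏ i, (L.choose (a i) : ℝ) / 2 ^ L
  have hC0 : ∀ a, 0 ≤ C a := fun a => Finset.prod_nonneg fun i _ => by positivity
  have hC1 : ∑ a ∈ S, C a = 1 := by
    have := prod_one_add_div_two_pow L (fun _ : I => (1 : ℂ))
    simp only [one_pow, Finset.prod_const_one, mul_one] at this
    apply Complex.ofReal_injective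
    rw [Complex.ofReal_sum, Complex.ofReal_one, ← this]
    norm_num
  have hcard : S.card = (L + 1) ^ Fintype.card I := by
    rw [hS, Fintype.card_piFinset]
    simp
  have hCsq : 1 ≤ ((L : ℝ) + 1) ^ Fintype.card I * ∑ a ∈ S, C a ^ 2 := by
    have := sq_sum_le_card_mul_sum_sq (s := S) (f := C)
    rw [hC1, hcard] at this
    push_cast at this
    simpa using this
  let U : (I → ℕ) × (I → ℕ) → V := fun x => ∑ i, ((x.1 i : ℤ) - x.2 i) • u i
  let Θ : (I → ℕ) × (I → ℕ) → UnitAddCircle := fun x => ∑ i, ((x.1 i : ℤ) - x.2 i) • θ i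
  obtain ⟨φ, hφ⟩ := exists_re_sum_toCircle_ge (S ×ˢ S) U
    (fun x => ((C x.1 * C x.2 : ℝ) : ℂ) * (AddCircle.toCircle (-Θ x) : ℂ))
  have hP : ∑ x ∈ S ×ˢ S, ((C x.1 * C x.2 : ℝ) : ℂ) * (AddCircle.toCircle (-Θ x) : ℂ) *
      (AddCircle.toCircle (φ (U x)) : ℂ) =
      ((‖∏ i, ((1 + (AddCircle.toCircle (φ (u i) - θ i) : ℂ)) / 2) ^ L‖ ^ 2 : ℝ) : ℂ) := by
    push_cast
    rw [← Complex.mul_conj', prod_one_add_div_two_pow]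
    simp only [toCircle_sum_nsmul]
    rw [map_sum, Finset.sum_mul_sum, ← Finset.sum_product']
    refine Finset.sum_congr rfl fun x _ => ?_
    rw [map_mul, Complex.conj_ofReal, ← Circle.coe_inv_eq_conj, ← AddCircle.toCircle_neg]
    have e1 : φ (U x) + (-Θ x) = (∑ i, x.1 i • (φ (u i) - θ i)) + -∑ i, x.2 i • (φ (u i) - θ i) := by
      simp only [U, Θ, map_sum, map_zsmul, ← Finset.sum_neg_distrib, ← Finset.sum_add_distrib]
      refine Finset.sum_congr rfl fun i _ => ?_
      simp only [sub_smul, natCast_zsmul, smul_sub]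
      abel
    have e2 : (AddCircle.toCircle (-Θ x) : ℂ) * (AddCircle.toCircle (φ (U x)) : ℂ) =
        (AddCircle.toCircle (∑ i, x.1 i • (φ (u i) - θ i)) : ℂ) *
        (AddCircle.toCircle (-∑ i, x.2 i • (φ (u i) - θ i)) : ℂ) := by
      rw [mul_comm, ← Circle.coe_mul, ← Circle.coe_mul, ← AddCircle.toCircle_add,
        ← AddCircle.toCircle_add, e1]
    rw [mul_assoc, e2]
    simp only [C]
    push_cast
    ring
  rw [hP, Complex.ofReal_re] at hφ
  have hlow : ∑ a ∈ S, C a ^ 2 ≤ (∑ x ∈ S ×ˢ S with U x = 0,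
      ((C x.1 * C x.2 : ℝ) : ℂ) * (AddCircle.toCircle (-Θ x) : ℂ)).re := by
    have h1 : ∑ x ∈ S ×ˢ S with U x = 0,
        ((C x.1 * C x.2 : ℝ) : ℂ) * (AddCircle.toCircle (-Θ x) : ℂ) =
        ((∑ x ∈ S ×ˢ S with U x = 0, C x.1 * C x.2 : ℝ) : ℂ) := by
      rw [Complex.ofReal_sum]
      refine Finset.sum_congr rfl fun x hx => ?_
      obtain ⟨hx1, hx2⟩ := Finset.mem_filter.1 hx
      obtain ⟨ha, hb⟩ := Finset.mem_product.1 hx1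
      have : Θ x = 0 := by
        refine hrel (fun i => (x.1 i : ℤ) - x.2 i) (fun i => ?_) hx2
        have h3 := Finset.mem_range.1 (Fintype.mem_piFinset.1 ha i)
        have h4 := Finset.mem_range.1 (Fintype.mem_piFinset.1 hb i)
        rw [abs_le]
        constructor <;> omega
      rw [this]
      simp
    rw [h1, Complex.ofReal_re]
    have h2 : ∑ a ∈ S, C a ^ 2 = ∑ x ∈ S.image (fun a => (a, a)), C x.1 * C x.2 := by
      rw [Finset.sum_image (fun a _ b _ h => congrArg Prod.fst h)]
      exact Finset.sum_congr rfl fun a _ => sq (C a)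
    rw [h2]
    refine Finset.sum_le_sum_of_subset_of_nonneg ?_ fun x _ _ => mul_nonneg (hC0 _) (hC0 _)
    intro x hx
    obtain ⟨a, ha, rfl⟩ := Finset.mem_image.1 hx
    simp [ha, U]
  refine ⟨φ, fun i => ?_⟩
  by_contra! hi
  have hup : ‖∏ i, ((1 + (AddCircle.toCircle (φ (u i) - θ i) : ℂ)) / 2) ^ L‖ ≤ ρ ^ L := by
    rw [norm_prod, ← Finset.mul_prod_erase _ _ (Finset.mem_univ i)]
    refine (mul_le_of_le_one_right (norm_nonneg _) ?_).trans ?_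
    · refine Finset.prod_le_one (fun _ _ => norm_nonneg _) fun k _ => ?_
      rw [norm_pow]
      refine pow_le_one₀ (norm_nonneg _) ?_
      rw [norm_div, RCLike.norm_ofNat, div_le_one two_pos]
      refine (norm_add_le _ _).trans ?_
      rw [norm_one, Circle.norm_coe]
      norm_num
    · rw [norm_pow]
      exact pow_le_pow_left₀ (norm_nonneg _) (hρ _ hi) _
  have h5 : ∑ a ∈ S, C a ^ 2 ≤ (ρ ^ 2) ^ L := by
    refine (hlow.trans hφ).trans ?_
    rw [← pow_mul, mul_comm, pow_mul]
    exact pow_le_pow_left₀ (norm_nonneg _) hup 2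
  have h6 : ((L : ℝ) + 1) ^ Fintype.card I * ∑ a ∈ S, C a ^ 2 ≤
      ((L : ℝ) + 1) ^ Fintype.card I * (ρ ^ 2) ^ L :=
    mul_le_mul_of_nonneg_left h5 (by positivity)
  linarith

/-! ### Limits of characters along `p`. -/

theorem IsSelective.le_atTop {p : Ultrafilter ℕ} (hp : IsSelective p) : (p : Filter ℕ) ≤ atTop := by
  refine le_trans ?_ Nat.cofinite_eq_atTop.le
  intro s hs
  rw [mem_cofinite] at hs
  by_contra h
  have h2 : sᶜ ∈ p := Ultrafilter.compl_mem_iff_notMem.2 h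
  obtain ⟨n, -, hn⟩ := (Ultrafilter.finite_biUnion_mem_iff hs).1
    (show (⋃ n ∈ sᶜ, {n}) ∈ p by rwa [Set.biUnion_of_singleton])
  exact hp.1 n hn

/-- Pointwise limits of characters along an ultrafilter. -/
theorem exists_addMonoidHom_forall_tendsto {V ι : Type*} [AddCommGroup V] (p : Ultrafilter ι)
    (F : ι → V →+ UnitAddCircle) :
    ∃ φ : V →+ UnitAddCircle, ∀ v, Tendsto (fun n => F n v) p (𝓝 (φ v)) := by
  have h : ∀ v, ∃ t : UnitAddCircle, Tendsto (fun n => F n v) p (𝓝 t) := fun v => by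
    obtain ⟨t, -, ht⟩ := isCompact_univ.ultrafilter_le_nhds (p.map fun n => F n v) (by simp)
    exact ⟨t, ht⟩
  choose φ hφ using h
  refine ⟨AddMonoidHom.mk' φ fun a b => ?_, hφ⟩
  refine tendsto_nhds_unique (hφ (a + b)) ?_
  simpa only [map_add] using (hφ a).add (hφ b)

theorem norm_half_unitAddCircle : ‖((1 / 2 : ℝ) : UnitAddCircle)‖ = 1 / 2 := by
  rw [UnitAddCircle.norm_eq]
  norm_num [abs_of_pos]

/-- If the increments of a sequence decay geometrically, the sequence stays close. -/
theorem norm_sub_le_of_geometric {E : Type*} [SeminormedAddCommGroup E] {f : ℕ → E} {k : ℕ}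
    (h : ∀ j, k ≤ j → ‖f (j + 1) - f j‖ ≤ (1 / 2) ^ j / 8) (j : ℕ) (hj : k ≤ j) :
    ‖f j - f k‖ ≤ (1 / 2) ^ k / 4 - (1 / 2) ^ j / 4 := by
  induction j, hj using Nat.le_induction with
  | base => simp
  | succ j hj ih =>
    have h1 : f (j + 1) - f k = (f (j + 1) - f j) + (f j - f k) := by abel
    rw [h1]
    refine (norm_add_le _ _).trans ?_
    have := h j hj
    rw [pow_succ]
    linarith

/-! ### Characters vanishing in the limit on countably many sequences. -/

section Construction

variable {V : Type*} [AddCommGroup V] [Module ℚ V]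

/-- For `p`-many `n`, the relations with small coefficients between finitely many fixed vectors and
the `n`-th terms of finitely many sequences come from relations between the fixed vectors. -/
theorem eventually_forall_small_relation (p : Ultrafilter ℕ) {U : Submodule ℚ (ℕ → V)}
    (hU : ∀ u ∈ U, ∀ v, (∀ᶠ n in (p : Filter ℕ), u n = v) → v = 0)
    {I J : Type*} [Fintype I] [Fintype J] (e : I → V) (w : J → U) (L : ℕ) :
    ∀ᶠ n in (p : Filter ℕ), ∀ a : I ⊕ J → ℤ, (∀ x, |a x| ≤ L) →
      ∑ x, a x • Sum.elim e (fun j => (w j : ℕ → V) n) x = 0 → ∑ i, a (Sum.inl i) • e i = 0 := by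
  classical
  have hfin : (Set.Icc (fun _ => -(L : ℤ)) (fun _ => (L : ℤ)) : Set (I ⊕ J → ℤ)).Finite :=
    Set.finite_Icc _ _
  suffices h : ∀ a ∈ (Set.Icc (fun _ => -(L : ℤ)) (fun _ => (L : ℤ)) : Set (I ⊕ J → ℤ)),
      ∀ᶠ n in (p : Filter ℕ), ∑ x, a x • Sum.elim e (fun j => (w j : ℕ → V) n) x = 0 →
        ∑ i, a (Sum.inl i) • e i = 0 by
    filter_upwards [(eventually_all_finite hfin).2 h] with n hn a ha
    exact hn a ⟨fun x => (abs_le.1 (ha x)).1, fun x => (abs_le.1 (ha x)).2⟩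
  intro a _
  -- For fixed coefficients, a relation holding for `p`-many n makes a member of U `p`-constant, so
  -- its constant value is 0.
  rw [Ultrafilter.eventually_imp]
  intro hsum
  refine Eventually.of_forall fun _ => ?_
  rw [← neg_eq_zero]
  refine hU (∑ j, a (Sum.inr j) • (w j : ℕ → V))
    (U.sum_mem fun j _ => zsmul_mem (w j).2 _) _ ?_
  filter_upwards [hsum] with n hn
  rw [Fintype.sum_sum_type] at hn
  rw [Finset.sum_apply]
  exact eq_neg_of_add_eq_zero_right hn

variable {p : Ultrafilter ℕ} (hp : IsSelective p) {U : Submodule ℚ (ℕ → V)} [Countable U]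
  (hU : ∀ u ∈ U, ∀ v, (∀ᶠ n in (p : Filter ℕ), u n = v) → v = 0) {d : V} (hd : d ≠ 0)

include hp hU hd in
theorem exists_addMonoidHom_forall_tendsto_zero :
    ∃ φ : V →+ UnitAddCircle, φ d ≠ 0 ∧
      ∀ u ∈ U, Tendsto (fun n => φ (u n)) (p : Filter ℕ) (𝓝 0) := by
  obtain ⟨w, hw⟩ := exists_surjective_nat U
  -- The vectors whose values are preserved at stage m: `d` and all w_i(n) with i, n ≤ m.
  let e : ∀ m : ℕ, Option (Fin (m + 1) × Fin (m + 1)) → V := fun m o =>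
    o.elim d fun x => (w x.1 : ℕ → V) x.2
  have hε : ∀ m : ℕ, (0 : ℝ) < (1 / 2) ^ m / 8 := fun m => by positivity
  choose L hL using fun m : ℕ => exists_kronecker_bound (V := V)
    (Option (Fin (m + 1) × Fin (m + 1)) ⊕ Fin (m + 1)) (hε m)
  obtain ⟨C, hC, hCA⟩ := hp.exists_forall_lt_mem _ fun m =>
    eventually_forall_small_relation p hU (e m) (fun j : Fin (m + 1) => w j) (L m)
  have hCinf : C.Infinite := by
    intro hfin
    have : Cᶜ ∈ (p : Filter ℕ) := hp.le_atTop (Nat.cofinite_eq_atTop ▸ hfin.compl_mem_cofinite)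
    exact Ultrafilter.compl_mem_iff_notMem.1 this hC
  obtain ⟨N, hN, hNr⟩ : ∃ N : ℕ → ℕ, StrictMono N ∧ Set.range N = C :=
    ⟨Nat.nth (· ∈ C), Nat.nth_strictMono hCinf, Nat.range_nth_of_infinite hCinf⟩
  have hNC : ∀ k, N k ∈ C := fun k => hNr ▸ Set.mem_range_self k
  have hεN : ∀ k, (1 / 2 : ℝ) ^ N k / 8 ≤ (1 / 2) ^ k / 8 := fun k => by
    have := pow_le_pow_of_le_one (by norm_num : (0 : ℝ) ≤ 1 / 2) (by norm_num) (hN.id_le k)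
    simp only [id] at this
    linarith
  have hstep : ∀ (k : ℕ) (φ : V →+ UnitAddCircle), ∃ φ' : V →+ UnitAddCircle,
      ‖φ' d - φ d‖ ≤ (1 / 2) ^ k / 8 ∧
      (∀ i n, i ≤ N k → n ≤ N k →
        ‖φ' ((w i : ℕ → V) n) - φ ((w i : ℕ → V) n)‖ ≤ (1 / 2) ^ k / 8) ∧
      ∀ i, i ≤ N k → ‖φ' ((w i : ℕ → V) (N (k + 1)))‖ ≤ (1 / 2) ^ k / 8 := by
    intro k φ
    obtain ⟨φ', hφ'⟩ := hL (N k)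
      (Sum.elim (e (N k)) fun j : Fin (N k + 1) => (w j : ℕ → V) (N (k + 1)))
      (Sum.elim (fun o => φ (e (N k) o)) 0) (by
        intro a ha hsum
        have := hCA (N k) (hNC k) (N (k + 1)) (hNC _) (hN (Nat.lt_succ_self k)) a ha hsum
        rw [Fintype.sum_sum_type]
        simp only [Sum.elim_inl, Sum.elim_inr, Pi.zero_apply, smul_zero, Finset.sum_const_zero,
          add_zero]
        rw [← map_zero φ, ← this, map_sum]
        simp only [map_zsmul])
    refine ⟨φ', ?_, ?_, ?_⟩
    · exact (hφ' (Sum.inl none)).le.trans (hεN k)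
    · intro i n hi hn
      exact (hφ' (Sum.inl (some (⟨i, by omega⟩, ⟨n, by omega⟩)))).le.trans (hεN k)
    · intro i hi
      have := (hφ' (Sum.inr ⟨i, by omega⟩)).le.trans (hεN k)
      simpa using this
  choose step hs1 hs2 hs3 using hstep
  obtain ⟨ψ, hψ⟩ := exists_addMonoidHom_unitAddCircle_apply_eq_half hd
  obtain ⟨F, hF0, hFs⟩ : ∃ F : ℕ → V →+ UnitAddCircle, F 0 = ψ ∧ ∀ k, F (k + 1) = step k (F k) :=
    ⟨fun k => Nat.rec ψ step k, rfl, fun _ => rfl⟩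
  -- Compactness supplies the limit on all of V; closeness to the stages is controlled only on
  -- preserved vectors. At `d` the total drift is at most 1/4, while ψ(d) has norm 1/2.
  obtain ⟨φ, hφ⟩ := exists_addMonoidHom_forall_tendsto p F
  have hlim : ∀ (v : V) (k : ℕ), (∀ j, k ≤ j → ‖F (j + 1) v - F j v‖ ≤ (1 / 2) ^ j / 8) →
      ‖φ v - F k v‖ ≤ (1 / 2) ^ k / 4 := by
    intro v k h
    refine le_of_tendsto ((hφ v).sub_const (F k v)).norm ?_
    filter_upwards [hp.le_atTop (eventually_ge_atTop k)] with j hj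
    have := norm_sub_le_of_geometric (f := fun j => F j v) h j hj
    have h2 : (0 : ℝ) ≤ (1 / 2) ^ j / 4 := by positivity
    linarith
  refine ⟨φ, fun h0 => ?_, fun u hu => ?_⟩
  · have := hlim d 0 fun j _ => by rw [hFs]; exact hs1 j _
    rw [h0, hF0, hψ, zero_sub, norm_neg, norm_half_unitAddCircle] at this
    norm_num at this
  · obtain ⟨i, hi⟩ := hw ⟨u, hu⟩
    have hwu : (w i : ℕ → V) = u := by rw [hi]
    rw [Metric.tendsto_nhds]
    intro ε hε
    obtain ⟨K, hK⟩ := exists_pow_lt_of_lt_one hε (by norm_num : (1 / 2 : ℝ) < 1)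
    filter_upwards [hC, hp.le_atTop (eventually_gt_atTop (N (max K i)))] with n hn hnK
    rw [← hNr] at hn
    obtain ⟨j, rfl⟩ := hn
    have hj := hN.lt_iff_lt.1 hnK
    obtain ⟨j, rfl⟩ : ∃ j', j = j' + 1 := ⟨j - 1, by omega⟩
    have hij : ∀ k, j ≤ k → i ≤ N k := fun k hk => by
      have := hN.id_le k
      simp only [id] at this
      omega
    have h1 := hs3 j (F j) i (hij j le_rfl)
    rw [← hFs, hwu] at h1
    have h2 := hlim (u (N (j + 1))) (j + 1) fun k hk => by
      have := hs2 k (F k) i (N (j + 1)) (hij k (by omega)) (hN.monotone hk)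
      rwa [← hFs, hwu] at this
    rw [dist_zero_right]
    have h3 : ‖φ (u (N (j + 1)))‖ ≤ ‖φ (u (N (j + 1))) - F (j + 1) (u (N (j + 1)))‖ +
        ‖F (j + 1) (u (N (j + 1)))‖ := by
      simpa using norm_add_le (φ (u (N (j + 1))) - F (j + 1) (u (N (j + 1))))
        (F (j + 1) (u (N (j + 1))))
    have h4 : (1 / 2 : ℝ) ^ j ≤ (1 / 2) ^ K :=
      pow_le_pow_of_le_one (by norm_num) (by norm_num) (by omega)
    rw [pow_succ] at h2
    have h5 : (0 : ℝ) ≤ (1 / 2) ^ j := by positivity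
    linarith

/-- A sequence with infinitely many values has subsequences that are eventually different from
countably many prescribed sequences. -/
theorem exists_subseq_eventually_ne {X K : Type*} [Countable K] {x : ℕ → X}
    (hx : ∀ m, (x '' Set.Ici m).Infinite) (h : K → ℕ → X) :
    ∃ σ : ℕ → ℕ, (∀ n, n ≤ σ n) ∧ ∀ k, ∀ᶠ n in atTop, x (σ n) ≠ h k n := by
  obtain ⟨f, hf⟩ := exists_injective_nat K
  have : ∀ n, ∃ m, n ≤ m ∧ ∀ k, f k ≤ n → x m ≠ h k n := by
    intro n
    have hfin : ((fun k => h k n) '' (f ⁻¹' Set.Iic n)).Finite :=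
      ((Set.finite_Iic n).preimage hf.injOn).image _
    obtain ⟨_, ⟨m, hm, rfl⟩, hm2⟩ := (hx n).exists_notMem_finite hfin
    exact ⟨m, hm, fun k hk he => hm2 ⟨k, hk, he.symm⟩⟩
  choose σ hσ1 hσ2 using this
  refine ⟨σ, hσ1, fun k => ?_⟩
  filter_upwards [eventually_ge_atTop (f k)] with n hn
  exact hσ2 n k hn

include hp hU hd in
theorem exists_addMonoidHom_not_tendsto {x : ℕ → V} (hx : ∀ m, (x '' Set.Ici m).Infinite) (l : V) :
    ∃ φ : V →+ UnitAddCircle,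
      (∀ u ∈ U, Tendsto (fun n => φ (u n)) (p : Filter ℕ) (𝓝 0)) ∧
      ¬ Tendsto (fun n => φ (x n)) atTop (𝓝 (φ l)) := by
  -- If u + q y with q ≠ 0 were `p`-constant, comparing index n with a fixed n₀ would express x(σ n)
  -- by one of these countably many sequences.
  obtain ⟨σ, hσ1, hσ2⟩ := exists_subseq_eventually_ne hx
    (fun (k : ℕ × ℕ × U) n => x k.1 + (k.2.2 : ℕ → V) n - (k.2.2 : ℕ → V) k.2.1)
  let y : ℕ → V := fun n => x (σ n) - l - d
  have hmem : ∀ z ∈ U ⊔ Submodule.span ℚ {y}, ∃ (u : U) (q : ℚ), z = u + q • y := by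
    intro z hz
    obtain ⟨u, hu, v, hv, rfl⟩ := Submodule.mem_sup.1 hz
    obtain ⟨q, rfl⟩ := Submodule.mem_span_singleton.1 hv
    exact ⟨⟨u, hu⟩, q, rfl⟩
  have hcount : Countable (U ⊔ Submodule.span ℚ {y} : Submodule ℚ (ℕ → V)) := by
    refine Set.countable_coe_iff.2 ((Set.countable_range
      (fun z : U × ℚ => (z.1 : ℕ → V) + z.2 • y)).mono fun z hz => ?_)
    obtain ⟨u, q, rfl⟩ := hmem z hz
    exact ⟨(u, q), rfl⟩
  obtain ⟨φ, hφd, hφ⟩ := exists_addMonoidHom_forall_tendsto_zero hp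
    (U := U ⊔ Submodule.span ℚ {y}) (fun z hz v hv => by
      obtain ⟨u, q, rfl⟩ := hmem z hz
      by_cases hq : q = 0
      · refine hU u u.2 v ?_
        filter_upwards [hv] with n hn
        simpa [hq] using hn
      · exfalso
        obtain ⟨n₀, hn₀⟩ := hv.exists
        obtain ⟨n, hn, hne⟩ := (hv.and (hp.le_atTop (hσ2 (σ n₀, n₀, -q⁻¹ • u)))).exists
        apply hne
        simp only [Pi.add_apply, Pi.smul_apply, Submodule.coe_smul, y] at hn hn₀ ⊢
        have h1 := hn.trans hn₀.symm
        have h2 := congrArg (fun t => q⁻¹ • t) h1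
        simp only [smul_add, smul_smul, inv_mul_cancel₀ hq, one_smul] at h2
        have h3 : x (σ n) = x (σ n₀) + q⁻¹ • (u : ℕ → V) n₀ - q⁻¹ • (u : ℕ → V) n := by
          have h4 : x (σ n) = (q⁻¹ • (u : ℕ → V) n + (x (σ n) - l - d)) -
            q⁻¹ • (u : ℕ → V) n + l + d := by abel
          rw [h4, h2]
          abel
        rw [h3, neg_smul, neg_smul]
        abel) hd
  refine ⟨φ, fun u hu => hφ u (Submodule.mem_sup_left hu), fun hlim => hφd ?_⟩
  have hy := hφ y (Submodule.mem_sup_right (Submodule.mem_span_singleton_self y))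
  have hσ : Tendsto σ p atTop :=
    (tendsto_atTop_mono hσ1 tendsto_id).mono_left hp.le_atTop
  have h2 := ((hlim.comp hσ).sub_const (φ l)).sub_const (φ d)
  have h3 := tendsto_nhds_unique hy (h2.congr fun n => by simp [y])
  simpa using h3

end Construction

/-! ### Ranks, closed sets and a basis modulo constants. -/

/-- Sequences, indexed by a type no larger than `ι`, with countable supports in `ι` can be assigned
distinct elements of `ι` of larger rank. -/
theorem exists_rank_injective {ι I : Type u} (hι : ℵ₀ ≤ #ι) (hpow : #ι ^ ℵ₀ = #ι) (hI : #I ≤ #ι)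
    (S : I → Set ι) (hS : ∀ b, (S b).Countable) :
    ∃ (ρ : ι → Ordinal.{u}) (j : I → ι), Function.Injective j ∧ ∀ b, ∀ η ∈ S b, ρ η < ρ (j b) := by
  have hle : (ℵ₁ : Cardinal.{u}) ≤ #ι := by
    rw [Cardinal.aleph_one_le_iff]
    calc ℵ₀ < 2 ^ ℵ₀ := Cardinal.cantor _
      _ ≤ #ι ^ ℵ₀ := Cardinal.power_le_power_right ((Cardinal.natCast_lt_aleph0 (n := 2)).le.trans hι)
      _ = #ι := hpow
  -- The first coordinate is the rank, where countable sets are bounded; the second carries b and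
  -- gives injectivity.
  have hcard : #ι = #((Ordinal.omega.{u} 1).ToType × ι) := by
    rw [Cardinal.mk_prod, Cardinal.lift_id, Cardinal.lift_id, ← Cardinal.ord_aleph,
      Cardinal.mk_ord_toType, Cardinal.mul_eq_right hι hle (Cardinal.aleph_pos 1).ne']
  obtain ⟨e⟩ := Cardinal.eq.1 hcard
  obtain ⟨g⟩ := (Cardinal.le_def I ι).1 hI
  let ρ : ι → Ordinal.{u} := fun η => ((e η).1.toOrd : Ordinal.{u})
  have hρ : ∀ η, ρ η < Ordinal.omega 1 := fun η => (e η).1.toOrd.2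
  have hsup : ∀ b, Order.succ (⨆ η : S b, ρ η) < Ordinal.omega 1 := fun b => by
    have := (hS b).to_subtype
    exact (Cardinal.isSuccLimit_omega 1).succ_lt (Ordinal.iSup_lt_omega_one fun η => hρ η)
  refine ⟨ρ, fun b => e.symm (Ordinal.ToType.mk ⟨_, hsup b⟩, g b), fun b b' h => ?_,
    fun b η hη => ?_⟩
  · exact g.injective (congrArg Prod.snd (e.symm.injective h))
  · have h1 : ρ (e.symm (Ordinal.ToType.mk ⟨_, hsup b⟩, g b)) = Order.succ (⨆ η : S b, ρ η) := by
      simp [ρ]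
    rw [h1, Order.lt_succ_iff]
    exact Ordinal.le_iSup (fun η : S b => ρ η) ⟨η, hη⟩

theorem exists_countable_closed_superset {ι : Type*} (T : ι → Set ι) (hT : ∀ ξ, (T ξ).Countable)
    {E₀ : Set ι} (hE₀ : E₀.Countable) :
    ∃ E : Set ι, E.Countable ∧ E₀ ⊆ E ∧ ∀ ξ ∈ E, T ξ ⊆ E := by
  let G : Set ι → Set ι := fun A => ⋃ ξ ∈ A, T ξ
  refine ⟨⋃ k, G^[k] E₀, Set.countable_iUnion fun k => ?_, Set.subset_iUnion (fun k => G^[k] E₀) 0,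
    fun ξ hξ => ?_⟩
  · induction k with
    | zero => exact hE₀
    | succ k ih =>
      rw [Function.iterate_succ_apply']
      exact ih.biUnion fun ξ _ => hT ξ
  · obtain ⟨k, hk⟩ := Set.mem_iUnion.1 hξ
    refine (Set.subset_biUnion_of_mem (u := T) hk).trans ?_
    refine Set.subset_iUnion_of_subset (k + 1) ?_
    rw [Function.iterate_succ_apply']

/-- A family of sequences forming a basis of an ultrapower modulo the constants. -/
structure IsBasisModConst (p : Ultrafilter ℕ) {V I : Type*} [AddCommGroup V] [Module ℚ V]
    (f : I → ℕ → V) : Prop where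
  span : ∀ g : ℕ → V, ∃ (a : I →₀ ℚ) (c : V),
    ∀ᶠ n in (p : Filter ℕ), g n = c + Finsupp.linearCombination ℚ f a n
  indep : ∀ (a : I →₀ ℚ) (c : V),
    (∀ᶠ n in (p : Filter ℕ), Finsupp.linearCombination ℚ f a n = c) → a = 0

theorem exists_isBasisModConst (p : Ultrafilter ℕ) (V : Type u) [AddCommGroup V] [Module ℚ V] :
    ∃ (I : Type u) (f : I → ℕ → V), IsBasisModConst p f ∧ #I ≤ #(ℕ → V) := by
  let N : Submodule ℚ (ℕ → V) :=
    { carrier := {g | ∃ c, ∀ᶠ n in (p : Filter ℕ), g n = c}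
      add_mem' := by
        rintro g h ⟨c, hc⟩ ⟨c', hc'⟩
        refine ⟨c + c', ?_⟩
        filter_upwards [hc, hc'] with n h1 h2
        simp [h1, h2]
      zero_mem' := ⟨0, Eventually.of_forall fun _ => rfl⟩
      smul_mem' := by
        rintro q g ⟨c, hc⟩
        refine ⟨q • c, ?_⟩
        filter_upwards [hc] with n h1
        simp [h1] }
  obtain ⟨C, hC⟩ := N.exists_isCompl
  let B := Module.Basis.ofVectorSpace ℚ C
  have hlc : ∀ a, Finsupp.linearCombination ℚ (fun b => (B b : ℕ → V)) a =
      (Finsupp.linearCombination ℚ B a : C) := fun a =>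
    (Finsupp.apply_linearCombination ℚ C.subtype B a).symm
  refine ⟨_, fun b => (B b : ℕ → V), ⟨fun g => ?_, fun a c h => ?_⟩, ?_⟩
  · obtain ⟨y, ⟨c, hc⟩, z, hz, rfl⟩ := Submodule.mem_sup.1
      (show g ∈ N ⊔ C by rw [hC.sup_eq_top]; trivial)
    refine ⟨B.repr ⟨z, hz⟩, c, ?_⟩
    filter_upwards [hc] with n hn
    rw [hlc, B.linearCombination_repr, Pi.add_apply, hn]
  · have h1 : Finsupp.linearCombination ℚ (fun b => (B b : ℕ → V)) a = 0 := by
      refine Submodule.disjoint_def.1 hC.disjoint _ ⟨c, h⟩ ?_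
      rw [hlc]
      exact Subtype.coe_prop _
    rw [hlc, Submodule.coe_eq_zero] at h1
    exact (linearIndependent_iff.1 B.linearIndependent) a h1
  · exact (Cardinal.mk_set_le _).trans (Cardinal.mk_set_le _)

/-- Subtracting constants does not affect independence modulo constants, so a `p`-constant
combination has zero coefficients. -/
theorem IsBasisModConst.eq_zero_of_eventually_eq {p : Ultrafilter ℕ} {V I : Type*} [AddCommGroup V]
    [Module ℚ V] {f : I → ℕ → V} (hf : IsBasisModConst p f) (c : I → V) (B : Set I)
    {u : ℕ → V} (hu : u ∈ LinearMap.range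
      (Finsupp.linearCombination ℚ fun b : B => f b - fun _ => c b)) {v : V}
    (huv : ∀ᶠ n in (p : Filter ℕ), u n = v) : v = 0 := by
  obtain ⟨a, rfl⟩ := hu
  have h1 : ∀ n, Finsupp.linearCombination ℚ (fun b : B => (f b - fun _ => c b : ℕ → V)) a n =
      Finsupp.linearCombination ℚ f (a.mapDomain (↑)) n -
        Finsupp.linearCombination ℚ (fun b : B => c b) a := by
    intro n
    rw [Finsupp.linearCombination_mapDomain]
    simp only [Finsupp.linearCombination_apply, Finsupp.sum, Finset.sum_apply, Pi.smul_apply,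
      Pi.sub_apply, Function.comp_apply, smul_sub, Finset.sum_sub_distrib]
  have h2 := hf.indep (a.mapDomain (↑)) (v + Finsupp.linearCombination ℚ (fun b : B => c b) a) (by
    filter_upwards [huv] with n hn
    rw [h1] at hn
    rw [← hn, sub_add_cancel])
  have h3 : a = 0 := Finsupp.mapDomain_injective Subtype.coe_injective
    (h2.trans Finsupp.mapDomain_zero.symm)
  obtain ⟨n, hn⟩ := huv.exists
  rw [← hn, h3]
  simp

/-! ### Limit preserving characters and their extension. -/

section Extension

variable {ι I : Type*} {p : Ultrafilter ℕ} (f : I → ℕ → ι →₀ ℚ) {j : I → ι}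

/-- The characters of `ι →₀ ℚ` for which every multiple of the sequence `f b` has the
corresponding multiple of the basis vector at `j b` as its limit along `p`. -/
def limitPreservingCharacters (p : Ultrafilter ℕ) (f : I → ℕ → ι →₀ ℚ) (j : I → ι) :
    Set ((ι →₀ ℚ) →+ UnitAddCircle) :=
  {φ | ∀ b (q : ℚ), Tendsto (fun n => φ (q • f b n)) (p : Filter ℕ)
    (𝓝 (φ (Finsupp.single (j b) q)))}

theorem liftAddHom_apply_congr {ψ ψ' : ι → ℚ →+ UnitAddCircle} {g : ι →₀ ℚ}
    (h : ∀ η ∈ g.support, ψ η = ψ' η) :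
    Finsupp.liftAddHom ψ g = Finsupp.liftAddHom ψ' g := by
  simp only [Finsupp.liftAddHom_apply]
  exact Finsupp.sum_congr fun η hη => by rw [h η hη]

/-- A character with the required limits on a closed set of coordinates agrees on these coordinates
with a character with all the required limits. -/
theorem exists_mem_limitPreservingCharacters (hj : Function.Injective j) {ρ : ι → Ordinal}
    (hρ : ∀ b n, ∀ η ∈ (f b n).support, ρ η < ρ (j b)) {E : Set ι}
    (hE : ∀ b, j b ∈ E → ∀ n, ((f b n).support : Set ι) ⊆ E) (φ : (ι →₀ ℚ) →+ UnitAddCircle)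
    (hφ : ∀ b, j b ∈ E → ∀ q : ℚ, Tendsto (fun n => φ (q • f b n)) (p : Filter ℕ)
      (𝓝 (φ (Finsupp.single (j b) q)))) :
    ∃ φ' ∈ limitPreservingCharacters p f j, ∀ g : ι →₀ ℚ, (g.support : Set ι) ⊆ E →
      φ' g = φ g := by
  classical
  choose lim hlim using fun F => exists_addMonoidHom_forall_tendsto (V := ℚ) p F
  -- Outside E the value at `j b` is forced to be the limit along f_b, whose supports have lower
  -- rank; the inner default 0 is never seen, and coordinates outside E and the range of `j` are
  -- free.
  let step : ∀ ξ, (∀ η, ρ η < ρ ξ → ℚ →+ UnitAddCircle) → ℚ →+ UnitAddCircle := fun ξ rec =>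
    if ξ ∈ E then φ.comp (Finsupp.singleAddHom ξ) else
      if h : ∃ b, j b = ξ then lim fun n =>
        (Finsupp.liftAddHom fun η => if hη : ρ η < ρ ξ then rec η hη else 0).comp
          (LinearMap.toSpanSingleton ℚ (ι →₀ ℚ) (f h.choose n)).toAddMonoidHom
      else 0
  have hwf : WellFounded fun η ξ => ρ η < ρ ξ := InvImage.wf ρ Ordinal.lt_wf
  let ψ : ι → ℚ →+ UnitAddCircle := hwf.fix step
  have hψ : ∀ ξ, ψ ξ = step ξ fun η _ => ψ η := fun ξ => hwf.fix_eq step ξ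
  have hψE : ∀ ξ ∈ E, ψ ξ = φ.comp (Finsupp.singleAddHom ξ) := fun ξ hξ => by
    rw [hψ]
    exact if_pos hξ
  have hag : ∀ g : ι →₀ ℚ, (g.support : Set ι) ⊆ E → Finsupp.liftAddHom ψ g = φ g := by
    intro g hg
    rw [liftAddHom_apply_congr fun η hη => hψE η (hg hη)]
    conv_rhs => rw [← Finsupp.sum_single g, Finsupp.sum, map_sum]
    rfl
  have hsingle : ∀ ξ q, Finsupp.liftAddHom ψ (Finsupp.single ξ q) = ψ ξ q := fun ξ q => by simp
  refine ⟨Finsupp.liftAddHom ψ, fun b q => ?_, hag⟩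
  rw [hsingle]
  by_cases hb : j b ∈ E
  · have h1 : ψ (j b) q = φ (Finsupp.single (j b) q) := by rw [hψE _ hb]; rfl
    rw [h1]
    refine (hφ b hb q).congr fun n => (hag _ ?_).symm
    exact (Finset.coe_subset.2 Finsupp.support_smul).trans (hE b hb n)
  · have hex : ∃ b', j b' = j b := ⟨b, rfl⟩
    have hch : hex.choose = b := hj hex.choose_spec
    have h1 : ψ (j b) = lim fun n =>
        (Finsupp.liftAddHom fun η => if ρ η < ρ (j b) then ψ η else 0).comp
          (LinearMap.toSpanSingleton ℚ (ι →₀ ℚ) (f b n)).toAddMonoidHom := by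
      rw [hψ]
      simp only [step, if_neg hb, dif_pos hex, hch, dite_eq_ite]
    rw [h1]
    refine (hlim _ q).congr fun n => ?_
    have h2 : (((Finsupp.liftAddHom fun η => if ρ η < ρ (j b) then ψ η else 0).comp
          (LinearMap.toSpanSingleton ℚ (ι →₀ ℚ) (f b n)).toAddMonoidHom) q) =
        Finsupp.liftAddHom (fun η => if ρ η < ρ (j b) then ψ η else 0) (q • f b n) := rfl
    rw [h2]
    refine liftAddHom_apply_congr fun η hη => ?_
    exact if_pos (hρ b n η (Finsupp.support_smul hη))

/-- Limits of arbitrary sequences along `p`, simultaneously for all limit preserving characters. -/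
theorem IsBasisModConst.exists_forall_tendsto {f : I → ℕ → ι →₀ ℚ} (hf : IsBasisModConst p f)
    (g : ℕ → ι →₀ ℚ) :
    ∃ l, ∀ φ ∈ limitPreservingCharacters p f j,
      Tendsto (fun n => φ (g n)) (p : Filter ℕ) (𝓝 (φ l)) := by
  obtain ⟨a, c, h⟩ := hf.span g
  refine ⟨c + ∑ b ∈ a.support, Finsupp.single (j b) (a b), fun φ hφ => ?_⟩
  have h1 : Tendsto (fun n => φ c + ∑ b ∈ a.support, φ (a b • f b n)) (p : Filter ℕ)
      (𝓝 (φ c + ∑ b ∈ a.support, φ (Finsupp.single (j b) (a b)))) :=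
    tendsto_const_nhds.add (tendsto_finsetSum _ fun b _ => hφ b (a b))
  rw [map_add, map_sum]
  refine h1.congr' ?_
  filter_upwards [h] with n hn
  rw [hn, map_add, Finsupp.linearCombination_apply, Finsupp.sum, Finset.sum_apply, map_sum]
  rfl

/-- Countably many coordinates only see countably many of the limits required of a limit preserving
character. -/
theorem IsBasisModConst.exists_countable_submodule {f : I → ℕ → ι →₀ ℚ}
    (hf : IsBasisModConst p f) (hj : Function.Injective j) {ρ : ι → Ordinal}
    (hρ : ∀ b n, ∀ η ∈ (f b n).support, ρ η < ρ (j b)) {E₀ : Set ι} (hE₀ : E₀.Countable) :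
    ∃ U : Submodule ℚ (ℕ → ι →₀ ℚ), Countable U ∧
      (∀ u ∈ U, ∀ v, (∀ᶠ n in (p : Filter ℕ), u n = v) → v = 0) ∧
      ∀ φ : (ι →₀ ℚ) →+ UnitAddCircle,
        (∀ u ∈ U, Tendsto (fun n => φ (u n)) (p : Filter ℕ) (𝓝 0)) →
        ∃ φ' ∈ limitPreservingCharacters p f j, ∀ g : ι →₀ ℚ, (g.support : Set ι) ⊆ E₀ →
          φ' g = φ g := by
  obtain ⟨E, hEc, hE₀E, hE⟩ := exists_countable_closed_superset
    (fun ξ => ⋃ b ∈ j ⁻¹' {ξ}, ⋃ n, ((f b n).support : Set ι))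
    (fun ξ => ((Set.countable_singleton ξ).preimage hj).biUnion fun b _ =>
      Set.countable_iUnion fun n => (f b n).support.countable_toSet) hE₀
  have : Countable (j ⁻¹' E) := (hEc.preimage hj).to_subtype
  refine ⟨LinearMap.range (Finsupp.linearCombination ℚ
    fun b : j ⁻¹' E => f b - fun _ => Finsupp.single (j b) 1), ?_,
    fun u hu v => hf.eq_zero_of_eventually_eq (fun b => Finsupp.single (j b) 1) (j ⁻¹' E) hu,
    fun φ hφ => ?_⟩
  · exact (Set.countable_range _).to_subtype
  · obtain ⟨φ', hφ', h⟩ := exists_mem_limitPreservingCharacters (p := p) f hj hρ (E := E)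
      (fun b hb n η hη => hE _ hb (Set.mem_biUnion (x := b) rfl (Set.mem_iUnion.2 ⟨n, hη⟩))) φ
      (fun b hb q => by
        have h1 := hφ _ ⟨Finsupp.single (⟨b, hb⟩ : j ⁻¹' E) q, rfl⟩
        have h2 := h1.add_const (φ (Finsupp.single (j b) q))
        rw [zero_add] at h2
        refine h2.congr fun n => ?_
        rw [← map_add]
        simp [smul_sub])
    exact ⟨φ', hφ', fun g hg => h g (hg.trans hE₀E)⟩

end Extension

/-! ### The topology and the main theorem. -/

theorem tendsto_iInf_induced {G H α : Type*} [AddCommGroup G] [AddCommGroup H]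
    [tH : TopologicalSpace H] (Φ : Set (G →+ H)) (F : Filter α) (x : α → G) (l : G) :
    Tendsto x F (@nhds G (⨅ φ ∈ Φ, TopologicalSpace.induced φ tH) l) ↔
      ∀ φ ∈ Φ, Tendsto (fun n => φ (x n)) F (𝓝 (φ l)) := by
  simp only [nhds_iInf, nhds_induced, tendsto_iInf, tendsto_comap_iff]
  rfl

theorem image_Ici_infinite_of_not_eventuallyConst {X : Type*} [TopologicalSpace X] [T1Space X]
    {x : ℕ → X} {l : X} (hx : Tendsto x atTop (𝓝 l)) (hc : ¬ EventuallyConst x atTop) (m : ℕ) :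
    (x '' Set.Ici m).Infinite := by
  intro hfin
  refine hc (EventuallyConst.of_tendsto (x := l) (tendsto_pure.2 ?_))
  have h1 : (x '' Set.Ici m \ {l})ᶜ ∈ 𝓝 l :=
    (hfin.subset Set.sdiff_subset).isClosed.isOpen_compl.mem_nhds fun h => h.2 rfl
  filter_upwards [hx h1, eventually_ge_atTop m] with n hn hm
  by_contra hne
  exact hn ⟨⟨n, hm, rfl⟩, hne⟩

theorem IsUltraCompact.countablyCompactSpace {p : Ultrafilter ℕ} (hp : (p : Filter ℕ) ≤ atTop)
    {X : Type u} [TopologicalSpace X] (h : IsUltraCompact p X) : CountablyCompactSpace X :=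
  isCountablyCompact_univ_iff.1 <| isCountablyCompact_iff_seq_clusterPt.2 fun x _ => by
    obtain ⟨l, hl⟩ := h x
    exact ⟨l, trivial, hl.mapClusterPt.mono hp⟩

theorem exists_ultraCompact_topology {p : Ultrafilter ℕ} (hp : IsSelective p) {ι : Type u}
    (hι : ℵ₀ ≤ #ι) (hpow : #ι ^ ℵ₀ = #ι) :
    ∃ τ : TopologicalSpace (ι →₀ ℚ),
      (∃ Φ : Set ((ι →₀ ℚ) →+ UnitAddCircle),
        τ = ⨅ φ ∈ Φ, TopologicalSpace.induced φ inferInstance) ∧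
      IsTopologicalAddGroup (ι →₀ ℚ) ∧
      T2Space (ι →₀ ℚ) ∧
      IsUltraCompact p (ι →₀ ℚ) ∧
      NoNontrivialConvergentSeq (ι →₀ ℚ) := by
  obtain ⟨I, f, hf, hI⟩ := exists_isBasisModConst p (ι →₀ ℚ)
  have : Infinite ι := Cardinal.infinite_iff.2 hι
  have hcard : #(ℕ → ι →₀ ℚ) = #ι := by
    simp [Cardinal.mk_pi, Cardinal.mk_finsupp_lift_of_infinite, hι, hpow]
  obtain ⟨ρ, j, hj, hρ⟩ := exists_rank_injective hι hpow (hI.trans hcard.le)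
    (fun b => ⋃ n, ((f b n).support : Set ι))
    (fun b => Set.countable_iUnion fun n => (f b n).support.countable_toSet)
  have hρ' : ∀ b n, ∀ η ∈ (f b n).support, ρ η < ρ (j b) := fun b n η hη =>
    hρ b η (Set.mem_iUnion.2 ⟨n, hη⟩)
  set Φ := limitPreservingCharacters p f j
  let τ : TopologicalSpace (ι →₀ ℚ) := ⨅ φ ∈ Φ, TopologicalSpace.induced φ inferInstance
  have hτ : ∀ {α : Type} (F : Filter α) (x : α → ι →₀ ℚ) l, Tendsto x F (𝓝 l) ↔
      ∀ φ ∈ Φ, Tendsto (fun n => φ (x n)) F (𝓝 (φ l)) := fun F x l =>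
    tendsto_iInf_induced Φ F x l
  have hT2 : T2Space (ι →₀ ℚ) := by
    refine ⟨fun x y hxy => ?_⟩
    have hd : x - y ≠ 0 := sub_ne_zero.2 hxy
    obtain ⟨U, hUc, hU, hext⟩ := hf.exists_countable_submodule hj hρ'
      (x - y).support.countable_toSet
    obtain ⟨φ, hφd, hφ⟩ := exists_addMonoidHom_forall_tendsto_zero hp hU hd
    obtain ⟨φ', hφ', hag⟩ := hext φ hφ
    have hcont : Continuous φ' :=
      continuous_iInf_dom (i := φ') (continuous_iInf_dom (i := hφ') continuous_induced_dom)
    refine separated_by_continuous hcont fun h => hφd ?_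
    rw [← hag _ subset_rfl, map_sub, h, sub_self]
  refine ⟨τ, ⟨Φ, rfl⟩, topologicalAddGroup_iInf fun φ => topologicalAddGroup_iInf fun _ =>
    topologicalAddGroup_induced φ, hT2, fun x => ?_, fun x l hx => ?_⟩
  · obtain ⟨l, hl⟩ := hf.exists_forall_tendsto (j := j) x
    exact ⟨l, (hτ _ _ _).2 hl⟩
  · by_contra hc
    have hinf := image_Ici_infinite_of_not_eventuallyConst hx hc
    obtain ⟨i⟩ : Nonempty ι := inferInstance
    have hd : Finsupp.single i (1 : ℚ) ≠ 0 := by simp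
    -- Extension must not change the values at l or at any x n, so all their supports are included.
    obtain ⟨U, hUc, hU, hext⟩ := hf.exists_countable_submodule hj hρ'
      (l.support.countable_toSet.union
        (Set.countable_iUnion fun n => (x n).support.countable_toSet))
    obtain ⟨φ, hφ, hnot⟩ := exists_addMonoidHom_not_tendsto hp hU hd hinf l
    obtain ⟨φ', hφ', hag⟩ := hext φ hφ
    refine hnot ?_
    rw [← hag l Set.subset_union_left]
    refine ((hτ _ _ _).1 hx φ' hφ').congr fun n => hag _ ?_
    exact (Set.subset_iUnion (fun n => ((x n).support : Set ι)) n).trans Set.subset_union_right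

theorem mainTheorem1 (p : Ultrafilter ℕ) (hp : IsSelective p) :
    (∀ κ : Cardinal.{u}, ℵ₀ ≤ κ → κ ^ ℵ₀ = κ → ∀ ι : Type u, #ι = κ →
      ∃ τ : TopologicalSpace (ι →₀ ℚ),
        (∃ Φ : Set ((ι →₀ ℚ) →+ UnitAddCircle),
          τ = ⨅ φ ∈ Φ, TopologicalSpace.induced φ inferInstance) ∧
        IsTopologicalAddGroup (ι →₀ ℚ) ∧
        T2Space (ι →₀ ℚ) ∧
        IsUltraCompact p (ι →₀ ℚ) ∧
        NoNontrivialConvergentSeq (ι →₀ ℚ)) ∧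
    (∀ μ : Cardinal.{u}, ∃ (G : Type u) (_ : AddCommGroup G) (_ : TopologicalSpace G),
      μ ≤ #G ∧
      IsAddTorsionFree G ∧
      IsTopologicalAddGroup G ∧
      T2Space G ∧
      CountablyCompactSpace G ∧
      NoNontrivialConvergentSeq G) := by
  refine ⟨fun κ hκ hpow ι hι => ?_, fun μ => ?_⟩
  · subst hι
    exact exists_ultraCompact_topology hp hκ hpow
  · have hle : max μ ℵ₀ ≤ max μ ℵ₀ ^ ℵ₀ := Cardinal.self_le_power _ Cardinal.one_le_aleph0
    have hmk : #(max μ ℵ₀ ^ ℵ₀).out = max μ ℵ₀ ^ ℵ₀ := Cardinal.mk_out _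
    have hι : ℵ₀ ≤ #(max μ ℵ₀ ^ ℵ₀).out := by
      rw [hmk]
      exact (le_max_right _ _).trans hle
    have : Infinite (max μ ℵ₀ ^ ℵ₀).out := Cardinal.infinite_iff.2 hι
    obtain ⟨τ, -, hgrp, hT2, hcomp, hseq⟩ := exists_ultraCompact_topology hp hι (by
      rw [hmk, ← Cardinal.power_mul, Cardinal.aleph0_mul_aleph0])
    refine ⟨_, inferInstance, τ, ?_, inferInstance, hgrp, hT2,
      hcomp.countablyCompactSpace hp.le_atTop, hseq⟩
    rw [Cardinal.mk_finsupp_lift_of_infinite, hmk, Cardinal.lift_uzero]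
    exact (le_max_left _ _).trans (hle.trans (le_max_left _ _))
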